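/- Let $R$ be an (associative, unital, not necessarily commutative) right coherent ring, and consider left $R$-modules. A module $M$ is \emph{Gorenstein flat} if $M\cong Z_0(T)$ for an acyclic complex $T$ of flat modules such that $I\otimes_R T$ is acyclic for every injective right $R$-module $I$, and it is \emph{cotorsion} if $\mathrm{Ext}^1_R(F,M)=0$ for every flat module $F$. Let $\mathcal{GF}(R)$ be the class of Gorenstein flat modules and let $(\mathcal{GF}\cap\mathcal{C})(R)$ be the full subcategory of modules that are both Gorenstein flat and cotorsion. This is a Frobenius category whose projective-injective objects are the flat cotorsion modules; its stable category $\underline{(\mathcal{GF}\cap\mathcal{C})}(R)$ has the same objects, and its morphisms are the $R$-linear maps modulo those that factor through a flat cotorsion module. An object $Y$ of an additive category with products is \emph{pure-injective} (in the sense of Saorín and Šťovíček) if for every set $I$ there is a morphism $f\colon Y^I\to Y$ with $f\circ\lambda_i=1_Y$ for all $i\in I$, where $\lambda_i\colon Y\to Y^I$ is the $i$-th canonical embedding. Suppose that $\mathcal{GF}(R)$ is closed under products. Then both $(\mathcal{GF}\cap\mathcal{C})(R)$ and $\underline{(\mathcal{GF}\cap\mathcal{C})}(R)$ have all set-indexed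 products, and an object $X$ of $(\mathcal{GF}\cap\mathcal{C})(R)$ is pure-injective in $(\mathcal{GF}\cap\mathcal{C})(R)$ if and only if it is pure-injective in $\underline{(\mathcal{GF}\cap\mathcal{C})}(R)$. -/

import Mathlib

open CategoryTheory CategoryTheory.Limits
open scoped TensorProduct

universe u

namespace GorensteinFlat

section Tensor

/-! The tensor product of a right and a left module over a ring that need not be commutative.
Right `R`-modules are modules over `Rᵐᵒᵖ`. -/

variable (R : Type u) [Ring R]

/-- The relations `(x • r) ⊗ m - x ⊗ (r • m)` inside `X ⊗[ℤ] M`. -/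
def balancedRelations (X M : Type u) [AddCommGroup X] [Module Rᵐᵒᵖ X]
    [AddCommGroup M] [Module R M] : AddSubgroup (X ⊗[ℤ] M) :=
  AddSubgroup.closure
    {t | ∃ (x : X) (r : R) (m : M), t = (MulOpposite.op r • x) ⊗ₜ[ℤ] m - x ⊗ₜ[ℤ] (r • m)}

/-- The abelian group `X ⊗_R M`. -/
abbrev BalancedTensor (X M : Type u) [AddCommGroup X] [Module Rᵐᵒᵖ X]
    [AddCommGroup M] [Module R M] : Type u :=
  (X ⊗[ℤ] M) ⧸ balancedRelations R X M

variable {R}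

/-- The homomorphism `g ⊗ f : X ⊗_R M → Y ⊗_R N`. -/
def balancedMap {X Y M N : Type u} [AddCommGroup X] [Module Rᵐᵒᵖ X]
    [AddCommGroup Y] [Module Rᵐᵒᵖ Y] [AddCommGroup M] [Module R M] [AddCommGroup N] [Module R N]
    (g : X →ₗ[Rᵐᵒᵖ] Y) (f : M →ₗ[R] N) : BalancedTensor R X M →+ BalancedTensor R Y N :=
  QuotientAddGroup.map _ _
    (TensorProduct.map g.toAddMonoidHom.toIntLinearMap
      f.toAddMonoidHom.toIntLinearMap).toAddMonoidHom (by
    rw [balancedRelations, AddSubgroup.closure_le]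
    rintro _ ⟨x, r, m, rfl⟩
    refine AddSubgroup.subset_closure ⟨g x, r, f m, ?_⟩
    simp)

/-- The class of `x ⊗ m` in `X ⊗_R M`. -/
def balancedTmul {X M : Type u} [AddCommGroup X] [Module Rᵐᵒᵖ X]
    [AddCommGroup M] [Module R M] (x : X) (m : M) : BalancedTensor R X M :=
  QuotientAddGroup.mk (x ⊗ₜ[ℤ] m)

lemma balancedMap_tmul {X Y M N : Type u} [AddCommGroup X] [Module Rᵐᵒᵖ X]
    [AddCommGroup Y] [Module Rᵐᵒᵖ Y] [AddCommGroup M] [Module R M] [AddCommGroup N] [Module R N]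
    (g : X →ₗ[Rᵐᵒᵖ] Y) (f : M →ₗ[R] N) (x : X) (m : M) :
    balancedMap g f (balancedTmul x m) = balancedTmul (g x) (f m) := rfl

lemma balanced_hom_ext {X M : Type u} [AddCommGroup X] [Module Rᵐᵒᵖ X]
    [AddCommGroup M] [Module R M] {A : Type u} [AddCommGroup A]
    {a b : BalancedTensor R X M →+ A}
    (h : ∀ x m, a (balancedTmul x m) = b (balancedTmul x m)) : a = b := by
  refine DFunLike.ext _ _ fun t => ?_
  obtain ⟨t, rfl⟩ := QuotientAddGroup.mk_surjective t
  induction t with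
  | zero => simp
  | tmul x m => exact h x m
  | add s t hs ht => rw [QuotientAddGroup.mk_add, map_add, map_add, hs, ht]

lemma balancedTmul_add {X M : Type u} [AddCommGroup X] [Module Rᵐᵒᵖ X]
    [AddCommGroup M] [Module R M] (x : X) (m n : M) :
    balancedTmul (R := R) x (m + n) = balancedTmul x m + balancedTmul x n := by
  simp only [balancedTmul, TensorProduct.tmul_add, QuotientAddGroup.mk_add]

lemma balancedMap_id {X M : Type u} [AddCommGroup X] [Module Rᵐᵒᵖ X]
    [AddCommGroup M] [Module R M] :
    balancedMap (LinearMap.id : X →ₗ[Rᵐᵒᵖ] X) (LinearMap.id : M →ₗ[R] M) = AddMonoidHom.id _ :=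
  balanced_hom_ext fun _ _ => rfl

lemma balancedMap_comp {X Y Z M N P : Type u} [AddCommGroup X] [Module Rᵐᵒᵖ X]
    [AddCommGroup Y] [Module Rᵐᵒᵖ Y] [AddCommGroup Z] [Module Rᵐᵒᵖ Z]
    [AddCommGroup M] [Module R M] [AddCommGroup N] [Module R N] [AddCommGroup P] [Module R P]
    (g : X →ₗ[Rᵐᵒᵖ] Y) (g' : Y →ₗ[Rᵐᵒᵖ] Z) (f : M →ₗ[R] N) (f' : N →ₗ[R] P) :
    balancedMap (g' ∘ₗ g) (f' ∘ₗ f) = (balancedMap g' f').comp (balancedMap g f) :=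
  balanced_hom_ext fun _ _ => rfl

lemma balancedMap_add {X Y M N : Type u} [AddCommGroup X] [Module Rᵐᵒᵖ X]
    [AddCommGroup Y] [Module Rᵐᵒᵖ Y] [AddCommGroup M] [Module R M] [AddCommGroup N] [Module R N]
    (g : X →ₗ[Rᵐᵒᵖ] Y) (f f' : M →ₗ[R] N) :
    balancedMap g (f + f') = balancedMap g f + balancedMap g f' :=
  balanced_hom_ext fun x m => by
    simp only [AddMonoidHom.add_apply, balancedMap_tmul, LinearMap.add_apply, balancedTmul_add]

/-- The functor `X ⊗_R -` from left `R`-modules to abelian groups. -/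
def tensorFunctor (X : ModuleCat.{u} Rᵐᵒᵖ) : ModuleCat.{u} R ⥤ AddCommGrpCat.{u} where
  obj M := AddCommGrpCat.of (BalancedTensor R X M)
  map f := AddCommGrpCat.ofHom (balancedMap LinearMap.id f.hom)
  map_id M := by
    rw [ModuleCat.hom_id, balancedMap_id]; rfl
  map_comp f g := by
    rw [ModuleCat.hom_comp, ← LinearMap.comp_id (LinearMap.id : X →ₗ[Rᵐᵒᵖ] X), balancedMap_comp]
    rfl

instance tensorFunctor_additive (X : ModuleCat.{u} Rᵐᵒᵖ) : (tensorFunctor X).Additive where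
  map_add {M N f g} := by
    change AddCommGrpCat.ofHom (balancedMap LinearMap.id (f + g).hom) = _
    rw [ModuleCat.hom_add, balancedMap_add]
    rfl

end Tensor

section Classes

variable {R : Type u} [Ring R]

/-- A left module `M` is flat if `- ⊗_R M` preserves monomorphisms of right modules. -/
def IsFlat (M : ModuleCat.{u} R) : Prop :=
  ∀ (X Y : ModuleCat.{u} Rᵐᵒᵖ) (g : X ⟶ Y), Function.Injective g.hom →
    Function.Injective (balancedMap g.hom (LinearMap.id : M →ₗ[R] M))

/-- A left module `M` is cotorsion if `Ext¹(F, M) = 0` for every flat module `F`. -/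
def IsCotorsion (M : ModuleCat.{u} R) : Prop :=
  ∀ F : ModuleCat.{u} R, IsFlat F → Subsingleton (Abelian.Ext F M 1)

/-- An acyclic complex of flat modules that stays acyclic under `I ⊗_R -` for every injective
right module `I`. -/
structure IsFTotallyAcyclic (T : ChainComplex (ModuleCat.{u} R) ℤ) : Prop where
  flat : ∀ i, IsFlat (T.X i)
  acyclic : T.Acyclic
  tensor_acyclic : ∀ I : ModuleCat.{u} Rᵐᵒᵖ, Injective I →
    (((tensorFunctor I).mapHomologicalComplex (ComplexShape.down ℤ)).obj T).Acyclic

/-- `M` is Gorenstein flat if it is the module of zero-cycles of an `F`-totally acyclic complex. -/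
def IsGorensteinFlat (M : ModuleCat.{u} R) : Prop :=
  ∃ T : ChainComplex (ModuleCat.{u} R) ℤ, IsFTotallyAcyclic T ∧ Nonempty (M ≅ T.cycles 0)

/-- The map `f` factors through a module that is both flat and cotorsion. -/
def FactorsFlatCotorsion {M N : ModuleCat.{u} R} (f : M ⟶ N) : Prop :=
  ∃ (F : ModuleCat.{u} R) (a : M ⟶ F) (b : F ⟶ N), IsFlat F ∧ IsCotorsion F ∧ a ≫ b = f

lemma isFlat_zero {M : ModuleCat.{u} R} (h : Subsingleton M) : IsFlat M := by
  intro X Y g _ s t _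
  have h0 : AddMonoidHom.id (BalancedTensor R X M) = 0 := balanced_hom_ext fun x m => by
    rw [Subsingleton.elim m 0]
    simp [balancedTmul]
  exact (DFunLike.congr_fun h0 s).trans (DFunLike.congr_fun h0 t).symm

lemma isFlat_biprod {M N : ModuleCat.{u} R} (hM : IsFlat M) (hN : IsFlat N) :
    IsFlat (M ⊞ N) := by
  intro X Y g hg
  rw [injective_iff_map_eq_zero]
  intro t ht
  have key : ∀ {P : ModuleCat.{u} R}, IsFlat P → ∀ p : M ⊞ N ⟶ P,
      balancedMap LinearMap.id p.hom t = 0 := by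
    intro P hP p
    apply (injective_iff_map_eq_zero _).1 (hP X Y g hg)
    rw [← AddMonoidHom.comp_apply, ← balancedMap_comp, LinearMap.id_comp, LinearMap.comp_id]
    rw [← LinearMap.id_comp g.hom, ← LinearMap.comp_id p.hom, balancedMap_comp,
      AddMonoidHom.comp_apply, ht, map_zero]
  have e : (LinearMap.id : (M ⊞ N : ModuleCat.{u} R) →ₗ[R] (M ⊞ N : ModuleCat.{u} R)) =
      (biprod.inl : M ⟶ M ⊞ N).hom ∘ₗ (biprod.fst : M ⊞ N ⟶ M).hom +
      (biprod.inr : N ⟶ M ⊞ N).hom ∘ₗ (biprod.snd : M ⊞ N ⟶ N).hom := by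
    rw [← ModuleCat.hom_comp, ← ModuleCat.hom_comp, ← ModuleCat.hom_add, biprod.total,
      ModuleCat.hom_id]
  have h1 := DFunLike.congr_fun (balancedMap_id (R := R) (X := X) (M := (M ⊞ N : ModuleCat R))) t
  rw [e, balancedMap_add, AddMonoidHom.add_apply,
    ← LinearMap.id_comp (LinearMap.id : X →ₗ[Rᵐᵒᵖ] X), balancedMap_comp, balancedMap_comp,
    AddMonoidHom.comp_apply, AddMonoidHom.comp_apply, key hM, key hN, map_zero, map_zero,
    add_zero] at h1
  exact h1.symm

lemma isCotorsion_of_isZero {M : ModuleCat.{u} R} (h : IsZero M) : IsCotorsion M := by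
  intro F _
  refine ⟨fun s t => ?_⟩
  have : ∀ s : Abelian.Ext F M 1, s = 0 := fun s => by
    rw [← Abelian.Ext.comp_mk₀_id s, h.eq_of_src (𝟙 M) 0, Abelian.Ext.mk₀_zero,
      Abelian.Ext.comp_zero]
  rw [this s, this t]

lemma isCotorsion_biprod {M N : ModuleCat.{u} R} (hM : IsCotorsion M) (hN : IsCotorsion N) :
    IsCotorsion (M ⊞ N) := by
  intro F hF
  have hM' := hM F hF
  have hN' := hN F hF
  have key : ∀ s : Abelian.Ext F (M ⊞ N) 1, s = 0 := by
    intro s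
    rw [← Abelian.Ext.comp_mk₀_id s, ← biprod.total, Abelian.Ext.mk₀_add, Abelian.Ext.comp_add,
      ← Abelian.Ext.mk₀_comp_mk₀, ← Abelian.Ext.mk₀_comp_mk₀,
      ← Abelian.Ext.comp_assoc_of_second_deg_zero, ← Abelian.Ext.comp_assoc_of_second_deg_zero,
      Subsingleton.elim (s.comp (Abelian.Ext.mk₀ biprod.fst) (add_zero 1)) 0,
      Subsingleton.elim (s.comp (Abelian.Ext.mk₀ biprod.snd) (add_zero 1)) 0,
      Abelian.Ext.zero_comp, Abelian.Ext.zero_comp, add_zero]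
  exact ⟨fun s t => by rw [key s, key t]⟩

lemma factors_zero (M N : ModuleCat.{u} R) : FactorsFlatCotorsion (0 : M ⟶ N) :=
  ⟨ModuleCat.of R PUnit, 0, 0, isFlat_zero (inferInstanceAs (Subsingleton PUnit)),
    isCotorsion_of_isZero (ModuleCat.isZero_of_subsingleton _), by simp⟩

lemma factors_add {M N : ModuleCat.{u} R} {f g : M ⟶ N} (hf : FactorsFlatCotorsion f)
    (hg : FactorsFlatCotorsion g) : FactorsFlatCotorsion (f + g) := by
  obtain ⟨F, a, b, h1, h2, rfl⟩ := hf
  obtain ⟨G, c, d, h3, h4, rfl⟩ := hg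
  exact ⟨F ⊞ G, biprod.lift a c, biprod.desc b d, isFlat_biprod h1 h3, isCotorsion_biprod h2 h4,
    by simp⟩

lemma factors_neg {M N : ModuleCat.{u} R} {f : M ⟶ N} (hf : FactorsFlatCotorsion f) :
    FactorsFlatCotorsion (-f) := by
  obtain ⟨F, a, b, h1, h2, rfl⟩ := hf
  exact ⟨F, a, -b, h1, h2, by simp⟩

lemma factors_comp_left {L M N : ModuleCat.{u} R} (e : L ⟶ M) {f : M ⟶ N}
    (hf : FactorsFlatCotorsion f) : FactorsFlatCotorsion (e ≫ f) := by
  obtain ⟨F, a, b, h1, h2, rfl⟩ := hf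
  exact ⟨F, e ≫ a, b, h1, h2, by simp⟩

lemma factors_comp_right {M N P : ModuleCat.{u} R} {f : M ⟶ N} (e : N ⟶ P)
    (hf : FactorsFlatCotorsion f) : FactorsFlatCotorsion (f ≫ e) := by
  obtain ⟨F, a, b, h1, h2, rfl⟩ := hf
  exact ⟨F, a, b ≫ e, h1, h2, by simp⟩

end Classes

section Categories

variable (R : Type u) [Ring R]

/-- Every finitely generated right ideal is finitely presented as a right module. -/
def IsRightCoherent : Prop :=
  ∀ J : Submodule Rᵐᵒᵖ R, J.FG → Module.FinitePresentation Rᵐᵒᵖ J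

/-- Products of (set-indexed families of) Gorenstein flat modules are Gorenstein flat. -/
def GorensteinFlatClosedUnderProducts : Prop :=
  ∀ (I : Type u) (M : I → ModuleCat.{u} R), (∀ i, IsGorensteinFlat (M i)) →
    IsGorensteinFlat (ModuleCat.of R (∀ i, M i))

/-- The full subcategory of `R`-modules that are both Gorenstein flat and cotorsion. -/
abbrev GFC : Type (u + 1) :=
  ObjectProperty.FullSubcategory
    (fun M : ModuleCat.{u} R => IsGorensteinFlat M ∧ IsCotorsion M)

/-- Two maps are identified if their difference factors through a flat cotorsion module; these
modules are the projective-injective objects of the Frobenius category `GFC R`. -/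
def stableRel : HomRel (GFC R) := fun _ _ f g => FactorsFlatCotorsion (f.hom - g.hom)

instance stableRel_congruence : Congruence (stableRel R) where
  equivalence :=
    { refl := fun f => by
        simpa [stableRel] using factors_zero _ _
      symm := fun {f g} h => by
        simpa [stableRel] using factors_neg h
      trans := fun {f g k} h h' => by
        simpa [stableRel] using factors_add h h' }
  comp_left := fun e f g h => by
    have := factors_comp_left e.hom h
    simpa [stableRel] using this
  comp_right := fun e h => by
    have := factors_comp_right e.hom h
    simpa [stableRel] using this

/-- The stable category of the Frobenius category `GFC R`. -/
abbrev StableGFC : Type (u + 1) := CategoryTheory.Quotient (stableRel R)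

instance stablePreadditive : Preadditive (StableGFC R) :=
  CategoryTheory.Quotient.preadditive (stableRel R) (by
    intro X Y f₁ f₂ g₁ g₂ h h'
    have e : (f₁ + g₁).hom - (f₂ + g₂).hom = (f₁.hom - f₂.hom) + (g₁.hom - g₂.hom) := by
      change (f₁.hom + g₁.hom) - (f₂.hom + g₂.hom) = _
      abel
    simpa only [stableRel, e] using factors_add h h')

/-- The canonical functor to the stable category. -/
abbrev stableFunctor : GFC R ⥤ StableGFC R := CategoryTheory.Quotient.functor (stableRel R)

end Categories

open Classical in
/-- `Y` is pure-injective in an additive category with products if for each set `I` there is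
`f : Y^I ⟶ Y` with `λ_i ≫ f = 𝟙 Y` for all `i : I`, where `λ_i : Y ⟶ Y^I` is the canonical
embedding, with components `𝟙 Y` at `i` and `0` elsewhere. -/
def IsPureInjective {A : Type (u + 1)} [Category.{u} A] [Preadditive A] [HasProducts.{u} A]
    (Y : A) : Prop :=
  ∀ I : Type u, ∃ f : (∏ᶜ fun _ : I => Y) ⟶ Y,
    ∀ i : I, Pi.lift (fun j : I => if j = i then 𝟙 Y else 0) ≫ f = 𝟙 Y

end GorensteinFlat

open GorensteinFlat

/-!
The functor to the stable category preserves products, so a splitting of the canonical embeddings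
`X ⟶ X^I` in `GFC R` gives one in the stable category. Conversely, let `f : X^I ⟶ X` split the
embeddings `λ i` only stably. The error `𝟙 X - λ i ≫ f` is a composite `X ⟶ E i ⟶ X` through a flat
cotorsion module. The quotient of `∏ i, E i` by `⨁ i, E i` is flat and `X` is cotorsion, so the maps
`E i ⟶ X` extend jointly from the direct sum to a map `∏ i, E i ⟶ X`. Adding the composite
`X^I ⟶ ∏ i, E i ⟶ X` to `f` gives an honest splitting (`exists_splitting_of_stable`).

Coherence enters through flatness. Over a right coherent ring the syzygies of a finite row
`r : ι → R` are generated by the columns of a finite matrix `a`, and a left module is flat exactly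
when every solution of `∑ i, r i • m i = 0` is a combination of these columns
(`IsFlat.solvedBy`, `isFlat_of_forall_solvedBy`). As `a` depends only on `r`, the condition passes to
products (`IsRightCoherent.isFlat_pi`) and to the quotient of a product by the direct sum
(`IsRightCoherent.isFlat_pi_quotient`). Together with the closure of cotorsion modules under products
(`isCotorsion_pi`), this shows that a map into a product factors through a flat cotorsion module as
soon as its components do, which is why products in `GFC R` stay products in the stable category.
-/

namespace GorensteinFlat

/-! ### Flat modules over right coherent rings -/

section Flatness

variable {R : Type u} [Ring R]

/-- Every solution in `M` of the equation `∑ i, r i • m i = 0` is an `M`-linear combination of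
the columns of the matrix `a`. -/
def SolvedBy {ι κ : Type*} [Fintype ι] [Fintype κ] (r : ι → R) (a : ι → κ → R)
    (M : Type*) [AddCommGroup M] [Module R M] : Prop :=
  ∀ m : ι → M, ∑ i, r i • m i = 0 → ∃ c : κ → M, ∀ i, m i = ∑ k, a i k • c k

/-- The homomorphism out of `X ⊗_R M` given by a balanced biadditive map. -/
def balancedLift {X M A : Type u} [AddCommGroup X] [Module Rᵐᵒᵖ X]
    [AddCommGroup M] [Module R M] [AddCommGroup A] (f : X →+ M →+ A)
    (hf : ∀ x (r : R) m, f (MulOpposite.op r • x) m = f x (r • m)) :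
    BalancedTensor R X M →+ A :=
  QuotientAddGroup.lift _
    (TensorProduct.liftAddHom f fun n x m => by simp) (by
      rw [balancedRelations, AddSubgroup.closure_le]
      rintro _ ⟨x, r, m, rfl⟩
      simp [hf])

lemma balancedLift_tmul {X M A : Type u} [AddCommGroup X] [Module Rᵐᵒᵖ X]
    [AddCommGroup M] [Module R M] [AddCommGroup A] (f : X →+ M →+ A)
    (hf : ∀ x (r : R) m, f (MulOpposite.op r • x) m = f x (r • m)) (x : X) (m : M) :
    balancedLift f hf (balancedTmul x m) = f x m := rfl

lemma add_balancedTmul {X M : Type u} [AddCommGroup X] [Module Rᵐᵒᵖ X]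
    [AddCommGroup M] [Module R M] (x y : X) (m : M) :
    balancedTmul (R := R) (x + y) m = balancedTmul x m + balancedTmul y m := by
  simp only [balancedTmul, TensorProduct.add_tmul, QuotientAddGroup.mk_add]

lemma op_smul_balancedTmul {X M : Type u} [AddCommGroup X] [Module Rᵐᵒᵖ X]
    [AddCommGroup M] [Module R M] (x : X) (r : R) (m : M) :
    balancedTmul (R := R) (MulOpposite.op r • x) m = balancedTmul x (r • m) := by
  unfold balancedTmul
  rw [← sub_eq_zero, ← QuotientAddGroup.mk_sub, QuotientAddGroup.eq_zero_iff]
  exact AddSubgroup.subset_closure ⟨x, r, m, rfl⟩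

lemma balancedTmul_zero {X M : Type u} [AddCommGroup X] [Module Rᵐᵒᵖ X]
    [AddCommGroup M] [Module R M] (x : X) :
    balancedTmul (R := R) x (0 : M) = 0 := by
  simp [balancedTmul]

lemma balancedTmul_sum {X M : Type u} [AddCommGroup X] [Module Rᵐᵒᵖ X]
    [AddCommGroup M] [Module R M] {ι : Type*} (s : Finset ι) (x : X) (m : ι → M) :
    balancedTmul (R := R) x (∑ i ∈ s, m i) = ∑ i ∈ s, balancedTmul x (m i) := by
  classical
  induction s using Finset.induction_on with
  | empty => simp [balancedTmul_zero]
  | insert i s hi ih => rw [Finset.sum_insert hi, Finset.sum_insert hi, balancedTmul_add, ih]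

/-- The homomorphism of right modules `x ↦ ∑ i, r i * x i`. -/
def rowMap {ι : Type*} [Fintype ι] (r : ι → R) : (ι → R) →ₗ[Rᵐᵒᵖ] R where
  toFun x := ∑ i, r i * x i
  map_add' x y := by simp [mul_add, Finset.sum_add_distrib]
  map_smul' s x := by
    simp [MulOpposite.smul_eq_mul_unop, Finset.sum_mul, mul_assoc]

lemma rowMap_apply {ι : Type*} [Fintype ι] (r : ι → R) (x : ι → R) :
    rowMap r x = ∑ i, r i * x i := rfl

/-- Over a right coherent ring the right module of syzygies of a finite row is finitely
generated; its generators are the columns of the matrix. -/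
lemma IsRightCoherent.exists_syzygies (hR : IsRightCoherent R) {ι : Type u} [Fintype ι]
    (r : ι → R) : ∃ (n : ℕ) (a : ι → Fin n → R),
      (∀ k, ∑ i, r i * a i k = 0) ∧ SolvedBy r a R := by
  have : Module.Finite Rᵐᵒᵖ R := ⟨⟨{1}, by
    rw [eq_top_iff]
    intro x _
    rw [Finset.coe_singleton, Submodule.mem_span_singleton]
    exact ⟨MulOpposite.op x, by simp [MulOpposite.smul_eq_mul_unop]⟩⟩⟩
  have hfg : (LinearMap.range (rowMap r)).FG := by
    rw [LinearMap.range_eq_map]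
    exact Submodule.FG.map _ Module.Finite.fg_top
  have := hR _ hfg
  have hker := Module.FinitePresentation.fg_ker (rowMap r).rangeRestrict
    (LinearMap.surjective_rangeRestrict _)
  rw [LinearMap.ker_rangeRestrict, Submodule.fg_iff_exists_fin_generating_family] at hker
  obtain ⟨n, s, hs⟩ := hker
  refine ⟨n, fun i k => s k i, fun k => ?_, fun m hm => ?_⟩
  · have : s k ∈ LinearMap.ker (rowMap r) := hs ▸ Submodule.subset_span ⟨k, rfl⟩
    exact this
  · have hm' : m ∈ Submodule.span Rᵐᵒᵖ (Set.range s) := by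
      rw [hs]
      exact hm
    obtain ⟨c, hc⟩ := (Submodule.mem_span_range_iff_exists_fun Rᵐᵒᵖ).1 hm'
    refine ⟨fun k => (c k).unop, fun i => ?_⟩
    rw [← hc, Finset.sum_apply]
    simp [MulOpposite.smul_eq_mul_unop]

/-- A flat module solves each linear equation by any matrix that solves it over the ring: the
kernel of `M^ι → M` is the image of `M^κ`, because tensoring `R^κ → R^ι → R` with `M` preserves
exactness. -/
lemma IsFlat.solvedBy {M : ModuleCat.{u} R} (hM : IsFlat M) {ι : Type u} {κ : Type*} [Fintype ι]
    [Fintype κ] {r : ι → R} {a : ι → κ → R} (h : SolvedBy r a R) : SolvedBy r a M := by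
  classical
  intro m hm
  -- the subgroup of `M^ι` generated by the columns of `a`
  let N : AddSubgroup (ι → M) := AddMonoidHom.range
    { toFun := fun (c : κ → M) i => ∑ k, a i k • c k
      map_zero' := by ext; simp
      map_add' := fun c d => by ext; simp [smul_add, Finset.sum_add_distrib] }
  let J := LinearMap.range (rowMap r)
  let p : (ι → R) →+ J := (rowMap r).rangeRestrict.toAddMonoidHom
  have hp : Function.Surjective p := LinearMap.surjective_rangeRestrict _
  let Φ : (ι → R) →+ M →+ (ι → M) ⧸ N := AddMonoidHom.mk'
    (fun x => (QuotientAddGroup.mk' N).comp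
      (AddMonoidHom.mk' (fun m i => x i • m) fun m n => by ext; simp))
    fun x y => by
      ext m
      change QuotientAddGroup.mk' N _ = QuotientAddGroup.mk' N _ + QuotientAddGroup.mk' N _
      rw [← map_add]
      congr 1
      ext i
      exact add_smul _ _ _
  have hΦ : p.ker ≤ Φ.ker := by
    intro x hx
    have hx' : ∑ i, r i * x i = 0 := congrArg Subtype.val hx
    obtain ⟨c, hc⟩ := h x hx'
    ext m
    change QuotientAddGroup.mk' N _ = 0
    rw [QuotientAddGroup.mk'_apply, QuotientAddGroup.eq_zero_iff]
    refine ⟨fun k => c k • m, ?_⟩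
    ext i
    change ∑ k, a i k • c k • m = x i • m
    rw [hc i, Finset.sum_smul]
    simp [mul_smul]
  let Ψ : J →+ M →+ (ι → M) ⧸ N := p.liftOfSurjective hp ⟨Φ, hΦ⟩
  have hΨ : ∀ x, Ψ (p x) = Φ x := fun x =>
    AddMonoidHom.liftOfRightInverse_comp_apply _ _ _ ⟨Φ, hΦ⟩ x
  let Θ : BalancedTensor R J M →+ (ι → M) ⧸ N := balancedLift Ψ (by
    intro j s m
    obtain ⟨x, rfl⟩ := hp j
    have : MulOpposite.op s • p x = p (MulOpposite.op s • x) :=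
      ((rowMap r).rangeRestrict.map_smul _ _).symm
    rw [this, hΨ, hΨ]
    change QuotientAddGroup.mk' N _ = QuotientAddGroup.mk' N _
    congr 1
    ext i
    simp [MulOpposite.smul_eq_mul_unop, mul_smul])
  let t : BalancedTensor R J M := ∑ i, balancedTmul (p (Pi.single i 1)) (m i)
  have ht : t = 0 := by
    have hinj := hM (ModuleCat.of Rᵐᵒᵖ J) (ModuleCat.of Rᵐᵒᵖ R) (ModuleCat.ofHom J.subtype)
      Subtype.val_injective
    apply (injective_iff_map_eq_zero _).1 hinj
    rw [map_sum]
    have : ∀ i, balancedMap J.subtype (LinearMap.id : M →ₗ[R] M)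
        (balancedTmul (p (Pi.single i 1)) (m i)) = balancedTmul (1 : R) (r i • m i) := by
      intro i
      rw [balancedMap_tmul, ← op_smul_balancedTmul]
      congr 1
      change ∑ j, r j * (Pi.single i 1 : ι → R) j = _
      simp [MulOpposite.smul_eq_mul_unop, Pi.single_apply]
    refine (Finset.sum_congr rfl fun i _ => this i).trans ?_
    rw [← balancedTmul_sum, hm, balancedTmul_zero]
  have ht' : Θ t = QuotientAddGroup.mk' N m := by
    rw [map_sum]
    have : ∀ i, Θ (balancedTmul (p (Pi.single i 1)) (m i)) =
        QuotientAddGroup.mk' N (Pi.single i (m i)) := by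
      intro i
      rw [balancedLift_tmul, hΨ]
      change QuotientAddGroup.mk' N _ = _
      congr 1
      ext j
      change (Pi.single i 1 : ι → R) j • m i = _
      by_cases hj : j = i
      · subst hj; simp
      · simp [hj]
    rw [Finset.sum_congr rfl fun i _ => this i, ← map_sum, Finset.univ_sum_single]
  rw [ht, map_zero, eq_comm, QuotientAddGroup.mk'_apply, QuotientAddGroup.eq_zero_iff] at ht'
  obtain ⟨c, hc⟩ := ht'
  exact ⟨c, fun i => (congrFun hc i).symm⟩

/-- The character group `Hom_ℤ(M, ℚ/ℤ)` of a left module; the ring is recorded for the sake of the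
right action. -/
abbrev CharacterDual (R : Type u) (M : Type u) [Ring R] [AddCommGroup M] [Module R M] : Type u :=
  M →+ AddCircle (1 : ℚ)

/-- The right action `(φ • r) m = φ (r • m)` on characters. -/
@[reducible]
def characterDualModule (M : Type u) [AddCommGroup M] [Module R M] :
    Module Rᵐᵒᵖ (CharacterDual R M) where
  smul s φ := φ.comp (DistribSMul.toAddMonoidHom M s.unop)
  one_smul φ := by ext m; exact congrArg φ (one_smul R m)
  mul_smul s t φ := by ext m; exact congrArg φ (mul_smul t.unop s.unop m)
  smul_zero s := rfl
  smul_add s φ ψ := rfl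
  add_smul s t φ := by
    ext m
    exact (congrArg φ (add_smul s.unop t.unop m)).trans (map_add φ _ _)
  zero_smul φ := by
    ext m
    exact (congrArg φ (zero_smul R m)).trans (map_zero φ)

attribute [local instance] characterDualModule

lemma characterDual_smul_apply {M : Type u} [AddCommGroup M] [Module R M] (s : Rᵐᵒᵖ)
    (φ : CharacterDual R M) (m : M) : (s • φ) m = φ (s.unop • m) := rfl

/-- If the solutions of every finite equation come from syzygies in the ring, then the character
module satisfies Baer's criterion: a homomorphism `g` on a right ideal `I` is evaluation of the
character `∑ r • m ↦ ∑ g r m` of the subgroup `I • M`, extended to `M`. -/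
lemma baer_characterDual {M : Type u} [AddCommGroup M] [Module R M]
    (h : ∀ (ι : Type u) [Fintype ι] (r : ι → R), ∃ (n : ℕ) (a : ι → Fin n → R),
      (∀ k, ∑ i, r i * a i k = 0) ∧ SolvedBy r a M) :
    Module.Baer Rᵐᵒᵖ (CharacterDual R M) := by
  classical
  intro I g
  let ev : (I →₀ M) →+ M := Finsupp.liftAddHom fun s =>
    DistribSMul.toAddMonoidHom M (s : Rᵐᵒᵖ).unop
  let G : (I →₀ M) →+ AddCircle (1 : ℚ) := Finsupp.liftAddHom fun s => g s
  have hker : ev.ker ≤ G.ker := by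
    intro x hx
    have hx' : ∑ s : x.support, (s : Rᵐᵒᵖ).unop • x s = 0 := by
      rw [Finset.sum_coe_sort x.support (fun s : I => (s : Rᵐᵒᵖ).unop • x s)]
      exact hx
    obtain ⟨n, a, ha, hM⟩ := h x.support fun s => (s : Rᵐᵒᵖ).unop
    obtain ⟨c, hc⟩ := hM (fun s => x s) hx'
    change ∑ s ∈ x.support, g s (x s) = 0
    rw [← Finset.sum_coe_sort x.support (fun s : I => g s (x s))]
    have h1 : ∀ s : x.support, g s (x s) = ∑ k, g (MulOpposite.op (a s k) • (s : I)) (c k) := by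
      intro s
      rw [hc s, map_sum]
      refine Finset.sum_congr rfl fun k _ => ?_
      rw [g.map_smul, characterDual_smul_apply, MulOpposite.unop_op]
    rw [Finset.sum_congr rfl fun s _ => h1 s, Finset.sum_comm]
    refine Finset.sum_eq_zero fun k _ => ?_
    rw [← AddMonoidHom.finsetSum_apply, ← map_sum]
    have h2 : ∑ s : x.support, MulOpposite.op (a s k) • (s : I) = 0 := by
      apply Subtype.ext
      apply MulOpposite.unop_injective
      simpa using ha k
    rw [h2, map_zero, AddMonoidHom.zero_apply]
  let e := ev.rangeRestrict
  have he : Function.Surjective e := AddMonoidHom.rangeRestrict_surjective _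
  have hker' : e.ker ≤ G.ker := by rwa [AddMonoidHom.ker_rangeRestrict]
  let φ₀ : ev.range →+ AddCircle (1 : ℚ) := e.liftOfSurjective he ⟨G, hker'⟩
  obtain ⟨φ, hφ⟩ := (Module.Baer.of_divisible (AddCircle (1 : ℚ))).extension_property_addMonoidHom
    ev.range.subtype Subtype.val_injective φ₀
  refine ⟨LinearMap.toSpanSingleton Rᵐᵒᵖ (CharacterDual R M) φ, fun s hs => ?_⟩
  ext m
  rw [LinearMap.toSpanSingleton_apply, characterDual_smul_apply]
  have h1 : φ₀ (e (Finsupp.single ⟨s, hs⟩ m)) = G (Finsupp.single ⟨s, hs⟩ m) :=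
    AddMonoidHom.liftOfRightInverse_comp_apply _ _ _ ⟨G, hker'⟩ _
  rw [← hφ] at h1
  simpa [ev, G, e] using h1

/-- Flatness by the equational criterion: a nonzero `t : X ⊗_R M` is detected by a character,
that is a homomorphism `X → Hom_ℤ(M, ℚ/ℤ)`, and this extends along every monomorphism. -/
lemma isFlat_of_forall_solvedBy {M : ModuleCat.{u} R}
    (h : ∀ (ι : Type u) [Fintype ι] (r : ι → R), ∃ (n : ℕ) (a : ι → Fin n → R),
      (∀ k, ∑ i, r i * a i k = 0) ∧ SolvedBy r a M) : IsFlat M := by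
  intro X Y g hg
  rw [injective_iff_map_eq_zero]
  intro t ht
  by_contra hne
  obtain ⟨χ, hχ⟩ := CharacterModule.exists_character_apply_ne_zero_of_ne_zero hne
  let χ' : BalancedTensor R X M →+ AddCircle (1 : ℚ) := χ
  let f : X →ₗ[Rᵐᵒᵖ] CharacterDual R M :=
    { toFun := fun x => AddMonoidHom.mk' (fun m => χ' (balancedTmul x m)) fun m n => by
        rw [balancedTmul_add, map_add]
      map_add' := fun x y => by
        ext m
        change χ' _ = χ' _ + χ' _
        rw [add_balancedTmul, map_add]
      map_smul' := fun s x => by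
        ext m
        exact congrArg χ' (op_smul_balancedTmul x s.unop m) }
  obtain ⟨f', hf'⟩ := (baer_characterDual h).extension_property g.hom hg f
  let F : Y →+ M →+ AddCircle (1 : ℚ) := f'.toAddMonoidHom
  -- `balancedLift` takes values in a group in `Type u`, whence the `ULift`
  let up : AddCircle (1 : ℚ) ≃+ ULift.{u} (AddCircle (1 : ℚ)) := AddEquiv.ulift.symm
  let Ξ : BalancedTensor R Y M →+ ULift.{u} (AddCircle (1 : ℚ)) :=
    balancedLift ((AddMonoidHom.compHom up.toAddMonoidHom).comp F) fun y r m =>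
      congrArg (fun φ : CharacterDual R M => up (φ m)) (f'.map_smul (MulOpposite.op r) y)
  have hΞ : Ξ.comp (balancedMap g.hom LinearMap.id) = up.toAddMonoidHom.comp χ' :=
    balanced_hom_ext fun x m =>
      congrArg (fun φ : X →ₗ[Rᵐᵒᵖ] CharacterDual R M => up (φ x m)) hf'
  have h0 := DFunLike.congr_fun hΞ t
  rw [AddMonoidHom.comp_apply, ht, map_zero] at h0
  exact hχ (up.injective (h0.symm.trans (map_zero up).symm))

/-- Over a right coherent ring a left module is flat as soon as it solves every finite equation
by each matrix that solves it over the ring. -/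
lemma IsRightCoherent.isFlat (hR : IsRightCoherent R) {M : ModuleCat.{u} R}
    (h : ∀ (ι : Type u) [Fintype ι] (n : ℕ) (r : ι → R) (a : ι → Fin n → R),
      SolvedBy r a R → SolvedBy r a M) : IsFlat M :=
  isFlat_of_forall_solvedBy fun ι _ r => by
    obtain ⟨n, a, ha, hs⟩ := hR.exists_syzygies r
    exact ⟨n, a, ha, h ι n r a hs⟩

lemma SolvedBy.pi {ι κ I : Type*} [Fintype ι] [Fintype κ] {r : ι → R} {a : ι → κ → R}
    {M : I → Type*} [∀ i, AddCommGroup (M i)] [∀ i, Module R (M i)]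
    (h : ∀ i, SolvedBy r a (M i)) : SolvedBy r a (∀ i, M i) := by
  intro m hm
  choose c hc using fun i => h i (fun j => m j i) (by simpa using congrFun hm i)
  refine ⟨fun k i => c i k, fun j => ?_⟩
  ext i
  simp [hc i j]

/-- Chase's theorem: over a right coherent ring products of flat left modules are flat. -/
lemma IsRightCoherent.isFlat_pi (hR : IsRightCoherent R) {I : Type u} {M : I → ModuleCat.{u} R}
    (hM : ∀ i, IsFlat (M i)) : IsFlat (ModuleCat.of R (∀ i, M i)) :=
  hR.isFlat fun _ _ _ _ _ hs => SolvedBy.pi fun i => (hM i).solvedBy hs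

/-- Over a right coherent ring the quotient of a product of flat modules by the direct sum is flat:
a relation in the quotient becomes a relation in the product after the finitely many coordinates
where it fails are replaced by zero. -/
lemma IsRightCoherent.isFlat_pi_quotient (hR : IsRightCoherent R) {I : Type u}
    {M : I → ModuleCat.{u} R} (hM : ∀ i, IsFlat (M i)) :
    IsFlat (ModuleCat.of R ((∀ i, M i) ⧸
      LinearMap.range (DFinsupp.coeFnLinearMap R : (Π₀ i, M i) →ₗ[R] ∀ i, M i))) := by
  classical
  refine hR.isFlat fun ι _ n r a hs q hq => ?_
  let N := LinearMap.range (DFinsupp.coeFnLinearMap R : (Π₀ i, M i) →ₗ[R] ∀ i, M i)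
  choose m hm using fun j => N.mkQ_surjective (q j)
  obtain ⟨x, hx⟩ : ∑ j, r j • m j ∈ N := by
    rw [← Submodule.Quotient.mk_eq_zero, ← Submodule.mkQ_apply, map_sum]
    simpa [hm] using hq
  let m' : ι → ∀ i, M i := fun j i => if x i = 0 then m j i else 0
  have hm' : ∀ j, N.mkQ (m' j) = q j := by
    intro j
    rw [← hm j, Submodule.mkQ_apply, Submodule.mkQ_apply, Submodule.Quotient.eq]
    refine ⟨DFinsupp.mk x.support fun i => -m j i, ?_⟩
    ext i
    by_cases hi : x i = 0 <;> simp [m', hi]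
  have hrel : ∑ j, r j • m' j = 0 := by
    ext i
    by_cases hi : x i = 0
    · have h0 : (∑ j, r j • m j) i = 0 := by
        rw [← hx]
        exact hi
      simpa [m', hi] using h0
    · simp [m', hi]
  obtain ⟨c, hc⟩ := SolvedBy.pi (fun i => (hM i).solvedBy hs) m' hrel
  refine ⟨fun k => N.mkQ (c k), fun j => ?_⟩
  rw [← hm' j, hc j, map_sum]
  rfl

end Flatness

/-! ### Products of cotorsion modules and extension of homomorphisms -/

section Cotorsion

variable {R : Type u} [Ring R]

/-- A homomorphism into a module `Y` extends along a monomorphism whose cokernel `C` satisfies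
`Ext¹(C, Y) = 0`. -/
lemma exists_extension_of_ext_eq_zero {S : ShortComplex (ModuleCat.{u} R)} (hS : S.ShortExact)
    {Y : ModuleCat.{u} R} (hY : Subsingleton (Abelian.Ext S.X₃ Y 1)) (φ : S.X₁ ⟶ Y) :
    ∃ ψ : S.X₂ ⟶ Y, S.f ≫ ψ = φ := by
  obtain ⟨x, hx⟩ := Abelian.Ext.contravariant_sequence_exact₁ hS _ (Abelian.Ext.mk₀ φ)
    (add_zero 1) (Subsingleton.elim _ _)
  obtain ⟨ψ, rfl⟩ := Abelian.Ext.addEquiv₀.symm.surjective x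
  refine ⟨ψ, Abelian.Ext.addEquiv₀.symm.injective ?_⟩
  simpa using hx

lemma isCotorsion_pi {I : Type u} {M : I → ModuleCat.{u} R} (hM : ∀ i, IsCotorsion (M i)) :
    IsCotorsion (ModuleCat.of R (∀ i, M i)) := by
  intro F hF
  have hS := F.shortExact_projectiveShortComplex
  have hproj : Projective F.projectiveShortComplex.X₂ :=
    (IsProjective.iff_projective (R := R) _).1 inferInstance
  have key : ∀ x : Abelian.Ext F (ModuleCat.of R (∀ i, M i)) 1, x = 0 := by
    intro x
    obtain ⟨y, rfl⟩ := Abelian.Ext.contravariant_sequence_exact₃ hS _ x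
      (Abelian.Ext.eq_zero_of_projective _) (add_zero 1)
    obtain ⟨φ, rfl⟩ := Abelian.Ext.addEquiv₀.symm.surjective y
    choose ψ hψ using fun i => exists_extension_of_ext_eq_zero hS (hM i F hF)
      (φ ≫ ModuleCat.ofHom (LinearMap.proj i))
    have hφ : φ = F.projectiveShortComplex.f ≫
        ModuleCat.ofHom (LinearMap.pi fun i => (ψ i).hom) := by
      ext z i
      exact (ConcreteCategory.congr_hom (hψ i) z).symm
    rw [hφ]
    change hS.extClass.comp (Abelian.Ext.mk₀ _) _ = 0
    rw [← Abelian.Ext.mk₀_comp_mk₀, ShortComplex.ShortExact.extClass_comp_assoc]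
  exact ⟨fun s t => by rw [key s, key t]⟩

/-- Over a right coherent ring, homomorphisms from flat modules to a cotorsion module extend
jointly from the direct sum to the product. -/
lemma IsCotorsion.exists_hom_pi (hR : IsRightCoherent R) {Y : ModuleCat.{u} R} (hY : IsCotorsion Y)
    {I : Type u} [DecidableEq I] {E : I → ModuleCat.{u} R} (hE : ∀ i, IsFlat (E i))
    (b : ∀ i, E i ⟶ Y) :
    ∃ h : ModuleCat.of R (∀ i, E i) ⟶ Y,
      ∀ i, ModuleCat.ofHom (LinearMap.single R (fun i => E i) i) ≫ h = b i := by
  let c : (Π₀ i, E i) →ₗ[R] ∀ i, E i := DFinsupp.coeFnLinearMap R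
  let S : ShortComplex (ModuleCat.{u} R) :=
    ModuleCat.shortComplexOfCompEqZero c c.range.mkQ c.range_mkQ_comp
  have hS : S.ShortExact := ModuleCat.shortComplex_shortExact S
    (LinearMap.exact_map_mkQ_range c) DFunLike.coe_injective (Submodule.mkQ_surjective _)
  obtain ⟨h, hh⟩ := exists_extension_of_ext_eq_zero hS (hY _ (hR.isFlat_pi_quotient hE))
    (ModuleCat.ofHom (DFinsupp.lsum ℕ fun i => (b i).hom))
  refine ⟨h, fun i => ?_⟩
  ext x
  have := ConcreteCategory.congr_hom hh (DFinsupp.single i x)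
  refine Eq.trans (congrArg h.hom ?_) (this.trans ?_)
  · exact (DFinsupp.single_eq_pi_single).symm
  · exact DFinsupp.lsum_single ..

end Cotorsion

/-! ### Products and pure-injectivity in the stable category -/

section Products

variable {R : Type u} [Ring R]

/-- The product of a family of Gorenstein flat cotorsion modules. -/
abbrev GFC.pi (hGF : GorensteinFlatClosedUnderProducts R) {I : Type u} (X : I → GFC R) : GFC R :=
  ⟨ModuleCat.of R (∀ i, (X i).obj), hGF I _ fun i => (X i).property.1,
    isCotorsion_pi fun i => (X i).property.2⟩

/-- The product of modules, as a fan in the full subcategory. -/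
abbrev GFC.fan (hGF : GorensteinFlatClosedUnderProducts R) {I : Type u} (X : I → GFC R) : Fan X :=
  Fan.mk (GFC.pi hGF X)
    fun i => ObjectProperty.homMk (ModuleCat.ofHom (LinearMap.proj i))

/-- The product of modules is a product in the full subcategory. -/
def GFC.isLimitFan (hGF : GorensteinFlatClosedUnderProducts R) {I : Type u} (X : I → GFC R) :
    IsLimit (GFC.fan hGF X) :=
  Fan.IsLimit.mk _
    (fun s => ObjectProperty.homMk (ModuleCat.ofHom (LinearMap.pi fun i => (s.proj i).hom.hom)))
    (fun s i => rfl)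
    (fun s m hm => by
      ext x
      funext i
      exact congrArg (fun f : s.pt ⟶ X i => f.hom x) (hm i))

/-- Over a right coherent ring, a map into a product factors through a flat cotorsion module as
soon as its components do. -/
lemma factorsFlatCotorsion_pi (hR : IsRightCoherent R) {I : Type u} {N : ModuleCat.{u} R}
    {M : I → ModuleCat.{u} R} (f : N ⟶ ModuleCat.of R (∀ i, M i))
    (h : ∀ i, FactorsFlatCotorsion (f ≫ ModuleCat.ofHom (LinearMap.proj i))) :
    FactorsFlatCotorsion f := by
  choose F a b hF hF' hab using h
  refine ⟨ModuleCat.of R (∀ i, F i), ModuleCat.ofHom (LinearMap.pi fun i => (a i).hom),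
    ModuleCat.ofHom (LinearMap.pi fun i => (b i).hom ∘ₗ LinearMap.proj i),
    hR.isFlat_pi hF, isCotorsion_pi hF', ?_⟩
  ext x i
  exact ConcreteCategory.congr_hom (hab i) x

lemma stableFunctor_map_eq_iff {X Y : GFC R} (f g : X ⟶ Y) :
    (stableFunctor R).map f = (stableFunctor R).map g ↔ FactorsFlatCotorsion (f.hom - g.hom) :=
  CategoryTheory.Quotient.functor_map_eq_iff _ f g

lemma stableFunctor_map_surjective {X Y : GFC R} :
    Function.Surjective ((stableFunctor R).map : (X ⟶ Y) → _) :=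
  Functor.map_surjective _

/-- The image of a product fan in the stable category. -/
abbrev StableGFC.fan (hGF : GorensteinFlatClosedUnderProducts R) {I : Type u}
    (X : I → GFC R) : Fan fun i => (stableFunctor R).obj (X i) :=
  Fan.mk ((stableFunctor R).obj (GFC.pi hGF X))
    fun i => (stableFunctor R).map ((GFC.fan hGF X).proj i)

/-- The canonical functor to the stable category preserves products, because flat cotorsion
modules are closed under products. -/
noncomputable def StableGFC.isLimitFan (hR : IsRightCoherent R)
    (hGF : GorensteinFlatClosedUnderProducts R) {I : Type u} (X : I → GFC R) :
    IsLimit (StableGFC.fan hGF X) :=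
  Fan.IsLimit.mk _
    (fun s => (stableFunctor R).map (X := s.pt.as) (Fan.IsLimit.lift (GFC.isLimitFan hGF X)
      fun i => (stableFunctor_map_surjective (s.proj i)).choose))
    (fun s i => by
      refine ((stableFunctor R).map_comp _ _).symm.trans ?_
      rw [Fan.IsLimit.fac]
      exact (stableFunctor_map_surjective (s.proj i)).choose_spec)
    (fun s m hm => by
      obtain ⟨m, rfl⟩ := stableFunctor_map_surjective (X := s.pt.as) (Y := GFC.pi hGF X) m
      rw [stableFunctor_map_eq_iff]
      apply factorsFlatCotorsion_pi hR
      intro i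
      have h1 : (stableFunctor R).map (m ≫ (GFC.fan hGF X).proj i) =
          (stableFunctor R).map (stableFunctor_map_surjective (s.proj i)).choose := by
        rw [Functor.map_comp]
        exact (hm i).trans (stableFunctor_map_surjective (s.proj i)).choose_spec.symm
      rw [stableFunctor_map_eq_iff] at h1
      exact (congrArg FactorsFlatCotorsion (Preadditive.sub_comp _ _ _)).mpr h1)

lemma GFC.hasProducts (hGF : GorensteinFlatClosedUnderProducts R) : HasProducts.{u} (GFC R) :=
  hasProducts_of_limit_fans (GFC.fan hGF) (GFC.isLimitFan hGF)

lemma StableGFC.hasProducts (hR : IsRightCoherent R)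
    (hGF : GorensteinFlatClosedUnderProducts R) : HasProducts.{u} (StableGFC R) :=
  hasProducts_of_limit_fans (fun X => StableGFC.fan hGF fun i => (X i).as)
    fun X => StableGFC.isLimitFan hR hGF fun i => (X i).as

open Classical in
/-- Pure-injectivity may be tested on any choice of powers of the object. -/
lemma isPureInjective_iff_of_isLimit {A : Type (u + 1)} [Category.{u} A] [Preadditive A]
    [HasProducts.{u} A] {Y : A} (c : ∀ I : Type u, Fan fun _ : I => Y)
    (hc : ∀ I, IsLimit (c I)) :
    IsPureInjective Y ↔ ∀ I, ∃ f : (c I).pt ⟶ Y, ∀ (i : I) (l : Y ⟶ (c I).pt),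
      (∀ j, l ≫ (c I).proj j = if j = i then 𝟙 Y else 0) → l ≫ f = 𝟙 Y := by
  constructor
  · intro h I
    obtain ⟨f, hf⟩ := h I
    refine ⟨Pi.lift (c I).proj ≫ f, fun i l hl => ?_⟩
    rw [← hf i, ← Category.assoc]
    congr 1
    ext j
    simp [hl]
  · intro h I
    obtain ⟨f, hf⟩ := h I
    refine ⟨Fan.IsLimit.lift (hc I) (Pi.π _) ≫ f, fun i => ?_⟩
    rw [← Category.assoc]
    apply hf i
    intro j
    simp

open Classical in
/-- The `i`-th canonical embedding of `X` into its power. -/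
noncomputable def GFC.powerInclusion (hGF : GorensteinFlatClosedUnderProducts R) (X : GFC R)
    {I : Type u} (i : I) : X ⟶ (GFC.pi hGF fun _ : I => X) :=
  Fan.IsLimit.lift (GFC.isLimitFan hGF fun _ : I => X) fun j => if j = i then 𝟙 X else 0

lemma GFC.isPureInjective_iff [HasProducts.{u} (GFC R)]
    (hGF : GorensteinFlatClosedUnderProducts R) (X : GFC R) :
    IsPureInjective X ↔ ∀ I : Type u, ∃ f : (GFC.pi hGF fun _ : I => X) ⟶ X,
      ∀ i, GFC.powerInclusion hGF X i ≫ f = 𝟙 X := by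
  classical
  rw [isPureInjective_iff_of_isLimit _ fun I => GFC.isLimitFan hGF fun _ : I => X]
  refine forall_congr' fun I => exists_congr fun f => forall_congr' fun i =>
    ⟨fun h => h _ fun j => ?_, fun h l hl => ?_⟩
  · rw [GFC.powerInclusion, Fan.IsLimit.fac]
  · rw [← h]
    congr 1
    apply Fan.IsLimit.hom_ext (GFC.isLimitFan hGF fun _ : I => X)
    intro j
    rw [hl, GFC.powerInclusion, Fan.IsLimit.fac]

lemma StableGFC.isPureInjective_iff [HasProducts.{u} (StableGFC R)] (hR : IsRightCoherent R)
    (hGF : GorensteinFlatClosedUnderProducts R) (X : GFC R) :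
    IsPureInjective ((stableFunctor R).obj X) ↔
      ∀ I : Type u, ∃ f : (GFC.pi hGF fun _ : I => X) ⟶ X,
        ∀ i, (stableFunctor R).map (GFC.powerInclusion hGF X i ≫ f) =
          (stableFunctor R).map (𝟙 X) := by
  classical
  have hproj : ∀ {I : Type u} (i j : I), (stableFunctor R).map (GFC.powerInclusion hGF X i) ≫
      (StableGFC.fan hGF fun _ : I => X).proj j = if j = i then 𝟙 _ else 0 := by
    intro I i j
    refine ((stableFunctor R).map_comp _ _).symm.trans ?_
    rw [GFC.powerInclusion, Fan.IsLimit.fac]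
    split_ifs
    · exact (stableFunctor R).map_id X
    · rfl
  rw [isPureInjective_iff_of_isLimit _ fun I => StableGFC.isLimitFan hR hGF fun _ : I => X]
  refine forall_congr' fun I => ⟨fun ⟨f, hf⟩ => ?_, fun ⟨f, hf⟩ => ?_⟩
  · obtain ⟨f, rfl⟩ := stableFunctor_map_surjective
      (X := GFC.pi hGF fun _ : I => X) (Y := X) f
    refine ⟨f, fun i => ?_⟩
    rw [CategoryTheory.Functor.map_comp, CategoryTheory.Functor.map_id]
    exact hf i _ fun j => by convert hproj i j
  · refine ⟨(stableFunctor R).map f, fun i l hl => ?_⟩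
    have : l = (stableFunctor R).map (GFC.powerInclusion hGF X i) := by
      apply Fan.IsLimit.hom_ext (StableGFC.isLimitFan hR hGF fun _ : I => X)
      intro j
      rw [hproj, hl]
    rw [this]
    exact ((stableFunctor R).map_comp _ _).symm.trans ((hf i).trans ((stableFunctor R).map_id X))

/-- A morphism `X^I ⟶ X` that splits the canonical embeddings up to maps through flat cotorsion
modules can be corrected to one that splits them: if the error at `i` is `X → E i → X`, the maps
`E i → X` extend jointly to the product of the `E i`, and the composite
`X^I → ∏ i, E i → X` is the correction. -/
lemma exists_splitting_of_stable (hR : IsRightCoherent R)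
    (hGF : GorensteinFlatClosedUnderProducts R) (X : GFC R) {I : Type u}
    (f : (GFC.pi hGF fun _ : I => X) ⟶ X)
    (hf : ∀ i, (stableFunctor R).map (GFC.powerInclusion hGF X i ≫ f) =
      (stableFunctor R).map (𝟙 X)) :
    ∃ f' : (GFC.pi hGF fun _ : I => X) ⟶ X,
      ∀ i, GFC.powerInclusion hGF X i ≫ f' = 𝟙 X := by
  classical
  have hfac : ∀ i, FactorsFlatCotorsion
      ((𝟙 X : X ⟶ X).hom - (GFC.powerInclusion hGF X i ≫ f).hom) :=
    fun i => (stableFunctor_map_eq_iff _ _).1 (hf i).symm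
  choose E a b hE _ hab using hfac
  obtain ⟨h, hh⟩ := X.property.2.exists_hom_pi hR hE b
  let e : (GFC.pi hGF fun _ : I => X).obj ⟶ ModuleCat.of R (∀ i, E i) :=
    ModuleCat.ofHom (LinearMap.pi fun i => (a i).hom ∘ₗ LinearMap.proj i)
  have he : ∀ i, (GFC.powerInclusion hGF X i).hom ≫ e =
      a i ≫ ModuleCat.ofHom (LinearMap.single R (fun i => E i) i) := by
    intro i
    ext x j
    change (a j).hom ((if j = i then 𝟙 X else 0 : X ⟶ X).hom x) =
      (Pi.single i ((a i).hom x) : ∀ i, E i) j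
    by_cases hj : j = i
    · subst hj
      simp
    · rw [if_neg hj, Pi.single_eq_of_ne hj]
      exact map_zero (a j).hom
  refine ⟨f + ObjectProperty.homMk (e ≫ h), fun i => ?_⟩
  apply ObjectProperty.hom_ext
  rw [Preadditive.comp_add]
  change (GFC.powerInclusion hGF X i ≫ f).hom + (GFC.powerInclusion hGF X i).hom ≫ e ≫ h = _
  rw [← Category.assoc, he, Category.assoc, hh, hab, add_sub_cancel]

end Products

end GorensteinFlat

open GorensteinFlat
theorem mainTheorem7 (R : Type u) [Ring R] (hR : IsRightCoherent R)
    (hGF : GorensteinFlatClosedUnderProducts R) :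
    ∃ (_ : HasProducts.{u} (GFC R)) (_ : HasProducts.{u} (StableGFC R)),
      ∀ X : GFC R, IsPureInjective X ↔ IsPureInjective ((stableFunctor R).obj X) := by
  refine ⟨GFC.hasProducts hGF, StableGFC.hasProducts hR hGF, fun X => ?_⟩
  have := GFC.hasProducts hGF
  have := StableGFC.hasProducts hR hGF
  rw [GFC.isPureInjective_iff hGF, StableGFC.isPureInjective_iff hR hGF]
  refine forall_congr' fun I => ⟨fun ⟨f, hf⟩ => ⟨f, fun i => by rw [hf]⟩, fun ⟨f, hf⟩ => ?_⟩
  exact exists_splitting_of_stable hR hGF X f hf
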